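/- Let $p,p',q,q'\in\mathbb{R}^3$ be such that the (closed, possibly degenerate) segments $[p,p']$ and $[q,q']$ do not intersect. Put $\Delta p=p'-p$, $\Delta q=q'-q$ and define the Gauss double integral $$T(p,p',q,q')=\frac12\int_0^1\int_0^1\frac{(q-p+s\,\Delta q-t\,\Delta p)\cdot(\Delta q\times\Delta p)}{\|q-p+s\,\Delta q-t\,\Delta p\|^3}\,\mathrm{d}s\,\mathrm{d}t .$$ For $(x,y)\in\mathbb{R}^2\setminus\{(0,0)\}$ let $\operatorname{atan2}(y,x)\in(-\pi,\pi]$ be the polar angle of $(x,y)$, i.e. the unique $\theta\in(-\pi,\pi]$ such that $x=R\cos\theta$ and $y=R\sin\theta$ for some $R>0$; for $\sigma\in\mathbb{Z}$ let the angle of the triple $[x,y,\sigma]$ be $\mathcal{A}([x,y,\sigma])=\operatorname{atan2}(y,x)+2\pi\sigma$. Let $s(x,y)=+1$ if $y>0$, or $y=0$ and $x<0$, and $s(x,y)=-1$ if $y<0$, or $y=0$ and $x>0$. Let $\alpha,\beta,\gamma,\omega$ be the unit vectors obtained by dividing $q-p$, $q-p'$, $q'-p'$, $q'-p$, respectively,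 by their Euclidean norms, and put $$x=1+\alpha\cdot\gamma+\alpha\cdot\beta+\beta\cdot\gamma,\qquad y=\beta\cdot(\alpha\times\gamma),$$ $$x'=1+\alpha\cdot\gamma+\alpha\cdot\omega+\omega\cdot\gamma,\qquad y'=\omega\cdot(\alpha\times\gamma),$$ $$x''=xx'+yy',\qquad y''=xy'-yx'.$$ Then $(x,y)$, $(x',y')$ and $(x'',y'')$ are all different from $(0,0)$, and $$T(p,p',q,q')=\mathcal{A}([x'',y'',\sigma'']),\qquad \sigma''=\begin{cases}-s(x'',y'')&\text{if } s(x'',y'')\,y>0,\\ 0&\text{otherwise.}\end{cases}$$ -/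

import Mathlib

/-- Euclidean three-space. -/
abbrev Space : Type := EuclideanSpace ℝ (Fin 3)

/-- The dot product of two spatial vectors. -/
noncomputable def dot (u v : Space) : ℝ := inner ℝ u v

/-- The cross product of two spatial vectors. -/
noncomputable def cross (u v : Space) : Space :=
  WithLp.toLp 2 (crossProduct (WithLp.ofLp u) (WithLp.ofLp v))

/-- The normalized vector `u / ‖u‖`. -/
noncomputable def unitVec (u : Space) : Space := ‖u‖⁻¹ • u

/-- The Gauss double integral of the segments `[p, p']` and `[q, q']`,
`(1/2) ∫₀¹ ∫₀¹ r ⬝ (Δq × Δp) / ‖r‖³ ds dt` with `r = q - p + s Δq - t Δp`. -/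
noncomputable def gaussT (p p' q q' : Space) : ℝ :=
  (1 / 2) * ∫ t in (0 : ℝ)..1, ∫ s in (0 : ℝ)..1,
    dot (q - p + s • (q' - q) - t • (p' - p)) (cross (q' - q) (p' - p)) /
      ‖q - p + s • (q' - q) - t • (p' - p)‖ ^ 3

/-- The four-quadrant arctangent, with values in `(-π, π]`. -/
noncomputable def atan2 (y x : ℝ) : ℝ := Complex.arg ⟨x, y⟩

/-- Away from the origin, `atan2 y x` is the unique polar angle of `(x, y)` in `(-π, π]`. -/
theorem atan2_eq_iff {x y : ℝ} (h : (x, y) ≠ (0, 0)) (θ : ℝ) :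
    atan2 y x = θ ↔
      ∃ R : ℝ, 0 < R ∧ R * Real.cos θ = x ∧ R * Real.sin θ = y ∧ θ ∈ Set.Ioc (-Real.pi) Real.pi := by
  constructor
  · rintro rfl
    have hz : (⟨x, y⟩ : ℂ) ≠ 0 := by
      intro h0
      apply h
      have h1 := congrArg Complex.re h0
      have h2 := congrArg Complex.im h0
      simp only [Complex.zero_re, Complex.zero_im] at h1 h2
      rw [h1, h2]
    exact ⟨‖(⟨x, y⟩ : ℂ)‖, norm_pos_iff.mpr hz, Complex.norm_mul_cos_arg _,
      Complex.norm_mul_sin_arg _, Complex.arg_mem_Ioc _⟩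
  · rintro ⟨R, hR, rfl, rfl, hθ⟩
    have h1 := Complex.arg_mul_cos_add_sin_mul_I hR hθ
    have h2 : (⟨R * Real.cos θ, R * Real.sin θ⟩ : ℂ) =
        (R : ℂ) * (Complex.cos θ + Complex.sin θ * Complex.I) := by
      apply Complex.ext <;> simp [Complex.cos_ofReal_re, Complex.sin_ofReal_re]
    rw [atan2, h2, h1]

/-- Triples `[x, y, σ]` with `(x, y) ∈ ℝ² ∖ {(0, 0)}` and `σ ∈ ℤ`. -/
structure AngleTriple where
  x : ℝ
  y : ℝ
  σ : ℤ
  ne_zero : (x, y) ≠ (0, 0)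

/-- The angle `atan2(y, x) + 2πσ` of a triple `[x, y, σ]`. -/
noncomputable def AngleTriple.angle (a : AngleTriple) : ℝ :=
  atan2 a.y a.x + 2 * Real.pi * (a.σ : ℝ)

open Classical in
/-- The sign of a point of `ℝ² ∖ {(0, 0)}`: it is `+1` if `y > 0`, or `y = 0` and `x < 0`, and
`-1` if `y < 0`, or `y = 0` and `x > 0`. -/
noncomputable def pointSign (x y : ℝ) : ℤ :=
  if 0 < y ∨ (y = 0 ∧ x < 0) then 1 else -1

theorem pointSign_eq_neg_one_iff {x y : ℝ} (h : (x, y) ≠ (0, 0)) :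
    pointSign x y = -1 ↔ y < 0 ∨ (y = 0 ∧ 0 < x) := by
  have h' : ¬ (x = 0 ∧ y = 0) := fun e => h (by rw [e.1, e.2])
  unfold pointSign
  rcases lt_trichotomy y 0 with hy | hy | hy <;> rcases lt_trichotomy x 0 with hx | hx | hx <;>
    simp_all [not_lt_of_gt, ne_of_gt, ne_of_lt]

open Classical in
/-- The integer `σ''`: it is `-s(x'', y'')` if `s(x'', y'') y > 0`, and `0` otherwise. -/
noncomputable def sigmaRule (y x'' y'' : ℝ) : ℤ :=
  if 0 < (pointSign x'' y'' : ℝ) * y then -pointSign x'' y'' else 0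

/-!
Put `a = q - p`, `b = q - p'`, `c = q' - p'`, `d = q' - p`, `U = q' - q`, `W = p' - p`. The double
integral runs over the parallelogram `r = a + s U - t W` with corners `a, b, c, d`, on which
`V = r ⬝ (U × W)` is constant; up to the factor `1/2` it is the signed solid angle of the
parallelogram seen from the origin.

If `V = 0`, the integral vanishes. Then `y = y' = 0`, and `x, x' > 0`: otherwise a column of the
adjugate of the singular Gram matrix of `α, β, γ` (or `α, ω, γ`) would give a nontrivial nonnegative
combination of `a, b, c, d` equal to `0`, that is, a common point of the segments
(`halfAngleC_re_pos`, `cone_ne_zero`).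

If `V ≠ 0`, the integrand `V / ‖r‖ ^ 3` has the explicit double primitive
`arctan ((r × U) ⬝ (r × W) / (V ‖r‖))`, an angle between two planes through the corner `r`, so the
integral is a signed sum of four arctangents (`integral_density`), up to right angles (which cancel
modulo `2 π`) and signs the arguments of corner
numbers `cornerC`. Cutting the spherical quadrilateral along the diagonal `α γ` and using that the
area of a spherical triangle is its angular excess (`prod_cornerC`), the product of the corner
numbers is a positive multiple of `z'' ^ 2`, where `z'' = x'' + i y'' = conj (x + i y) (x' + i y')`.
Hence `z'' ^ 2` is a positive multiple of `exp (2 i T)`, and `T` is the argument of `z''` up to a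
multiple of `π`. The multiple is `0`: `|T| < π` since four arctangents sum to less than `2 π`, while
`T` has the sign of `V` since the integrand does, and so does `y''` by a direct computation
(`im_halfAngleC_mul`). As `y` has the sign of `-V`, the rule for `σ''` gives `0`.
-/

/-! ### Dot, cross and triple products -/

theorem dot_eq (u v : Space) : dot u v = u 0 * v 0 + u 1 * v 1 + u 2 * v 2 := by
  simp [dot, PiLp.inner_apply, Fin.sum_univ_three]; ring

@[simp] theorem cross_apply_zero (u v : Space) : cross u v 0 = u 1 * v 2 - u 2 * v 1 := by
  simp [cross, crossProduct]

@[simp] theorem cross_apply_one (u v : Space) : cross u v 1 = u 2 * v 0 - u 0 * v 2 := by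
  simp [cross, crossProduct]

@[simp] theorem cross_apply_two (u v : Space) : cross u v 2 = u 0 * v 1 - u 1 * v 0 := by
  simp [cross, crossProduct]

theorem dot_comm (u v : Space) : dot u v = dot v u := real_inner_comm _ _

theorem dot_self (u : Space) : dot u u = ‖u‖ ^ 2 := real_inner_self_eq_norm_sq u

theorem dot_smul_left (k : ℝ) (u v : Space) : dot (k • u) v = k * dot u v :=
  real_inner_smul_left _ _ _

theorem dot_smul_right (k : ℝ) (u v : Space) : dot u (k • v) = k * dot u v :=
  real_inner_smul_right _ _ _

theorem dot_add_left (u v w : Space) : dot (u + v) w = dot u w + dot v w :=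
  inner_add_left _ _ _

theorem dot_add_right (u v w : Space) : dot u (v + w) = dot u v + dot u w :=
  inner_add_right _ _ _

theorem cross_smul_left (k : ℝ) (u v : Space) : cross (k • u) v = k • cross u v := by
  simp [cross]

theorem cross_smul_right (k : ℝ) (u v : Space) : cross u (k • v) = k • cross u v := by
  simp [cross]

theorem unitVec_norm {u : Space} (h : u ≠ 0) : ‖unitVec u‖ = 1 := norm_smul_inv_norm h

theorem dot_unitVec_self {u : Space} (h : u ≠ 0) : dot (unitVec u) (unitVec u) = 1 := by
  rw [dot_self, unitVec_norm h, one_pow]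

theorem norm_smul_unitVec {u : Space} (h : u ≠ 0) : ‖u‖ • unitVec u = u := by
  rw [unitVec, smul_smul, mul_inv_cancel₀ (norm_ne_zero_iff.mpr h), one_smul]

/-- The square of a triple product is the Gram determinant. -/
theorem triple_mul_self (u v w : Space) :
    dot u (cross v w) * dot u (cross v w) =
      dot u u * (dot v v * dot w w - dot v w ^ 2)
        - dot u v * (dot u v * dot w w - dot v w * dot u w)
        + dot u w * (dot u v * dot v w - dot v v * dot u w) := by
  simp only [dot_eq, cross_apply_zero, cross_apply_one, cross_apply_two]; ring

theorem gram_pos_of_triple {r U W : Space} (h : dot r (cross U W) ≠ 0) :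
    0 < dot r r * dot U U - dot r U ^ 2 := by
  have e : dot r r * dot U U - dot r U ^ 2 = dot (cross r U) (cross r U) := by
    simp only [dot_eq, cross_apply_zero, cross_apply_one, cross_apply_two]; ring
  rw [e, dot_self]
  apply pow_pos
  rw [norm_pos_iff]
  intro h0
  apply h
  have : dot r (cross U W) = dot (cross r U) W := by
    simp only [dot_eq, cross_apply_zero, cross_apply_one, cross_apply_two]; ring
  rw [this, h0]; simp [dot]

theorem ne_zero_of_triple {r U W : Space} (h : dot r (cross U W) ≠ 0) : r ≠ 0 := by
  rintro rfl; simp [dot] at h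

/-! ### The double primitive of the Gauss integrand -/

/-- With `V = r ⬝ (U × W)`, the area form of the Gauss map along the plane `r + span (U, W)` is
`V / ‖r‖ ^ 3`; this is its primitive in the direction `U`. -/
noncomputable def edgePrimitive (U : Space) (V : ℝ) (r : Space) : ℝ :=
  V * dot r U / (‖r‖ * (dot r r * dot U U - dot r U ^ 2))

/-- The numerator `(r × U) ⬝ (r × W)` of the tangent in `cornerPrimitive`. -/
noncomputable def cornerNum (U W r : Space) : ℝ := dot r r * dot U W - dot r U * dot r W

/-- Primitive of `V / ‖r‖ ^ 3` in both directions `U` and `-W`: up to a right angle and a sign,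
the dihedral angle between the planes spanned by `r, U` and by `r, W`. -/
noncomputable def cornerPrimitive (U W : Space) (V : ℝ) (r : Space) : ℝ :=
  Real.arctan (cornerNum U W r / (V * ‖r‖))

theorem hasDerivAt_norm {r : ℝ → Space} {X : Space} {s : ℝ} (hr : HasDerivAt r X s)
    (h0 : r s ≠ 0) : HasDerivAt (fun s => ‖r s‖) (dot (r s) X / ‖r s‖) s := by
  have h1 := hr.norm_sq.sqrt (by simpa using h0)
  simp only [Real.sqrt_sq (norm_nonneg _)] at h1
  convert h1 using 1
  rw [dot, mul_div_mul_left _ _ two_ne_zero]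

theorem hasDerivAt_dot {r : ℝ → Space} {X : Space} {s : ℝ} (hr : HasDerivAt r X s) (Y : Space) :
    HasDerivAt (fun s => dot (r s) Y) (dot X Y) s := by
  simpa [dot] using hr.inner ℝ (hasDerivAt_const s Y)

theorem hasDerivAt_dot_self {r : ℝ → Space} {X : Space} {s : ℝ} (hr : HasDerivAt r X s) :
    HasDerivAt (fun s => dot (r s) (r s)) (2 * dot (r s) X) s := by
  simpa [dot_self, dot] using hr.norm_sq

theorem hasDerivAt_edgePrimitive {r : ℝ → Space} {U W : Space} {V s : ℝ}
    (hr : HasDerivAt r U s) (h0 : dot (r s) (cross U W) ≠ 0) :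
    HasDerivAt (fun s => edgePrimitive U V (r s)) (V / ‖r s‖ ^ 3) s := by
  have hN := gram_pos_of_triple h0
  have hr0 := ne_zero_of_triple h0
  have hR : ‖r s‖ ≠ 0 := norm_ne_zero_iff.mpr hr0
  have h := ((hasDerivAt_dot hr U).const_mul V).div
    ((hasDerivAt_norm hr hr0).mul (((hasDerivAt_dot_self hr).mul_const (dot U U)).sub
      ((hasDerivAt_dot hr U).pow 2))) (mul_ne_zero hR hN.ne')
  refine h.congr_deriv ?_
  simp only [Pi.mul_apply, Pi.sub_apply, Pi.pow_apply]
  generalize dot (r s) U = k at *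
  rw [dot_self (r s)] at *
  generalize ‖r s‖ = R at *
  generalize dot U U = m at *
  have hN' := hN.ne'
  rw [div_eq_div_iff (by positivity) (by positivity)]
  norm_num
  field_simp

theorem hasDerivAt_cornerPrimitive {r : ℝ → Space} {U W : Space} {V t : ℝ}
    (hr : HasDerivAt r (-W) t) (hV : dot (r t) (cross U W) = V) (h0 : V ≠ 0) :
    HasDerivAt (fun t => cornerPrimitive U W V (r t)) (edgePrimitive U V (r t)) t := by
  have h0' : dot (r t) (cross U W) ≠ 0 := hV ▸ h0
  have hN := gram_pos_of_triple h0'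
  have hr0 := ne_zero_of_triple h0'
  have hR : ‖r t‖ ≠ 0 := norm_ne_zero_iff.mpr hr0
  have h := ((((hasDerivAt_dot_self hr).mul_const (dot U W)).sub
    ((hasDerivAt_dot hr U).mul (hasDerivAt_dot hr W))).div
      ((hasDerivAt_norm hr hr0).const_mul V) (mul_ne_zero h0 hR)).arctan
  refine h.congr_deriv ?_
  -- `‖(r × U) × (r × W)‖ = |V| ‖r‖`, whence the denominator of the derivative factors.
  have key : (V * ‖r t‖) ^ 2 + cornerNum U W (r t) ^ 2 =
      (dot (r t) (r t) * dot U U - dot (r t) U ^ 2) *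
        (dot (r t) (r t) * dot W W - dot (r t) W ^ 2) := by
    rw [mul_pow, ← dot_self, ← hV, sq (dot _ _), triple_mul_self]
    rw [cornerNum]; ring
  have hpos : (V * ‖r t‖) ^ 2 + cornerNum U W (r t) ^ 2 ≠ 0 := by positivity
  have e1 : dot (-W) W = - dot W W := by simp [dot]
  have e2 : dot (-W) U = - dot U W := by rw [dot_comm U W]; simp [dot]
  have e3 : dot (r t) (-W) = - dot (r t) W := by simp [dot]
  have hNW : dot (r t) (r t) * dot W W - dot (r t) W ^ 2 ≠ 0 := by
    intro h; rw [key, h, mul_zero] at hpos; exact hpos rfl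
  have e4 : ∀ A B : ℝ, B ≠ 0 → 1 / (1 + (A / B) ^ 2) = B ^ 2 / (B ^ 2 + A ^ 2) := by
    intro A B hB
    have : B ^ 2 + A ^ 2 ≠ 0 := by positivity
    field_simp
  simp only [Pi.mul_apply, Pi.sub_apply, Pi.div_apply]
  change 1 / (1 + (cornerNum U W (r t) / (V * ‖r t‖)) ^ 2) * _ = _
  rw [e4 _ _ (mul_ne_zero h0 hR), key, e1, e2, e3, edgePrimitive]
  rw [dot_self (r t)] at *
  generalize dot (r t) U = k at *
  generalize dot (r t) W = l at *
  generalize ‖r t‖ = R at *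
  generalize dot U U = m at *
  generalize dot W W = n at *
  have hN' := hN.ne'
  field_simp
  ring

/-! ### Integration over the parallelogram -/

/-- The point with parameters `s`, `t` of the plane through `a` spanned by `U` and `-W`. For
`0 ≤ s, t ≤ 1` and `a = q - p`, `U = q' - q`, `W = p' - p` these are the differences of a point of
`[q, q']` and a point of `[p, p']`. -/
noncomputable def diffPoint (a U W : Space) (s t : ℝ) : Space := a + s • U - t • W

theorem triple_diffPoint (a U W : Space) (s t : ℝ) :
    dot (diffPoint a U W s t) (cross U W) = dot a (cross U W) := by
  simp only [diffPoint, dot_eq, cross_apply_zero, cross_apply_one, cross_apply_two,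
    PiLp.add_apply, PiLp.sub_apply, PiLp.smul_apply, smul_eq_mul]
  ring

theorem hasDerivAt_diffPoint_left (a U W : Space) (s t : ℝ) :
    HasDerivAt (fun s => diffPoint a U W s t) U s := by
  simpa [diffPoint] using (((hasDerivAt_id s).smul_const U).const_add a).sub_const (t • W)

theorem hasDerivAt_diffPoint_right (a U W : Space) (s t : ℝ) :
    HasDerivAt (fun t => diffPoint a U W s t) (-W) t := by
  simpa [diffPoint] using ((hasDerivAt_id t).smul_const W).const_sub (a + s • U)

theorem continuous_diffPoint (a U W : Space) :
    Continuous fun x : ℝ × ℝ => diffPoint a U W x.1 x.2 := by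
  unfold diffPoint; fun_prop

theorem continuous_density {a U W : Space} {V : ℝ} (hV : dot a (cross U W) = V) (h0 : V ≠ 0) :
    Continuous fun x : ℝ × ℝ => V / ‖diffPoint a U W x.1 x.2‖ ^ 3 := by
  refine continuous_const.div ((continuous_diffPoint a U W).norm.pow 3) fun x => ?_
  refine pow_ne_zero 3 (norm_ne_zero_iff.mpr (ne_zero_of_triple (U := U) (W := W) ?_))
  rwa [triple_diffPoint, hV]

theorem continuous_integral_density {a U W : Space} {V : ℝ} (hV : dot a (cross U W) = V)
    (h0 : V ≠ 0) :
    Continuous fun t : ℝ => ∫ s in (0 : ℝ)..1, V / ‖diffPoint a U W s t‖ ^ 3 := by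
  have hf : Continuous (Function.uncurry fun t s : ℝ => V / ‖diffPoint a U W s t‖ ^ 3) := by
    have h := (continuous_density hV h0).comp continuous_swap
    simpa only [Function.comp_def, Function.uncurry_def, Prod.fst_swap, Prod.snd_swap] using h
  exact intervalIntegral.continuous_parametric_intervalIntegral_of_continuous' hf 0 1

/-- The solid angle of a parallelogram as a signed sum over its four corners. -/
theorem integral_density {a U W : Space} {V : ℝ} (hV : dot a (cross U W) = V) (h0 : V ≠ 0) :
    ∫ t in (0 : ℝ)..1, ∫ s in (0 : ℝ)..1, V / ‖diffPoint a U W s t‖ ^ 3 =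
      cornerPrimitive U W V (a + U - W) - cornerPrimitive U W V (a + U)
        - cornerPrimitive U W V (a - W) + cornerPrimitive U W V a := by
  have htr : ∀ s t, dot (diffPoint a U W s t) (cross U W) = V := fun s t => by
    rw [triple_diffPoint, hV]
  have hc := continuous_density hV h0
  have inner : ∀ t : ℝ, ∫ s in (0 : ℝ)..1, V / ‖diffPoint a U W s t‖ ^ 3 =
      edgePrimitive U V (diffPoint a U W 1 t) - edgePrimitive U V (diffPoint a U W 0 t) := by
    intro t
    refine intervalIntegral.integral_eq_sub_of_hasDerivAt
      (f := fun s => edgePrimitive U V (diffPoint a U W s t)) (fun s _ => ?_) ?_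
    · exact hasDerivAt_edgePrimitive (W := W) (hasDerivAt_diffPoint_left a U W s t)
        (by rw [htr]; exact h0)
    · exact (hc.comp (by fun_prop : Continuous fun s : ℝ => (s, t))).intervalIntegrable _ _
  have hcont := continuous_integral_density hV h0
  have outer := intervalIntegral.integral_eq_sub_of_hasDerivAt (a := 0) (b := 1)
    (f := fun t => cornerPrimitive U W V (diffPoint a U W 1 t) -
      cornerPrimitive U W V (diffPoint a U W 0 t))
    (f' := fun t : ℝ => ∫ s in (0 : ℝ)..1, V / ‖diffPoint a U W s t‖ ^ 3)
    (fun t _ => by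
      simp only [inner]
      exact (hasDerivAt_cornerPrimitive (hasDerivAt_diffPoint_right a U W 1 t) (htr 1 t) h0).sub
        (hasDerivAt_cornerPrimitive (hasDerivAt_diffPoint_right a U W 0 t) (htr 0 t) h0))
    (hcont.intervalIntegrable _ _)
  rw [outer]
  simp only [diffPoint, one_smul, zero_smul, add_zero, sub_zero]
  ring

theorem integral_density_pos {a U W : Space} {V : ℝ} (hV : dot a (cross U W) = V) (h0 : V ≠ 0) :
    0 < V * ∫ t in (0 : ℝ)..1, ∫ s in (0 : ℝ)..1, V / ‖diffPoint a U W s t‖ ^ 3 := by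
  have hc := continuous_density hV h0
  have hcont := continuous_integral_density hV h0
  rw [← intervalIntegral.integral_const_mul]
  refine intervalIntegral.intervalIntegral_pos_of_pos
    ((continuous_const.mul hcont).intervalIntegrable _ _) (fun t => ?_) one_pos
  rw [← intervalIntegral.integral_const_mul]
  refine intervalIntegral.intervalIntegral_pos_of_pos (Continuous.intervalIntegrable
    (continuous_const.mul (hc.comp (by fun_prop : Continuous fun s : ℝ => (s, t)))) _ _)
    (fun s => ?_) one_pos
  have hr : diffPoint a U W s t ≠ 0 := ne_zero_of_triple (U := U) (W := W) (by
    rwa [triple_diffPoint, hV])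
  change 0 < V * (V / ‖diffPoint a U W s t‖ ^ 3)
  have := norm_pos_iff.mpr hr
  rw [← mul_div_assoc]
  have := mul_self_pos.mpr h0
  positivity

theorem abs_integral_density_lt {a U W : Space} {V : ℝ} (hV : dot a (cross U W) = V)
    (h0 : V ≠ 0) :
    |∫ t in (0 : ℝ)..1, ∫ s in (0 : ℝ)..1, V / ‖diffPoint a U W s t‖ ^ 3| < 2 * Real.pi := by
  rw [integral_density hV h0, abs_lt]
  unfold cornerPrimitive
  have l := Real.neg_pi_div_two_lt_arctan
  have u := Real.arctan_lt_pi_div_two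
  constructor
  · linarith [l (cornerNum U W (a + U - W) / (V * ‖a + U - W‖)),
      u (cornerNum U W (a + U) / (V * ‖a + U‖)), u (cornerNum U W (a - W) / (V * ‖a - W‖)),
      l (cornerNum U W a / (V * ‖a‖))]
  · linarith [u (cornerNum U W (a + U - W) / (V * ‖a + U - W‖)),
      l (cornerNum U W (a + U) / (V * ‖a + U‖)), l (cornerNum U W (a - W) / (V * ‖a - W‖)),
      u (cornerNum U W a / (V * ‖a‖))]

theorem gaussT_eq (p p' q q' : Space) :
    gaussT p p' q q' = 1 / 2 * ∫ t in (0 : ℝ)..1, ∫ s in (0 : ℝ)..1,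
      dot (q - p) (cross (q' - q) (p' - p)) /
        ‖diffPoint (q - p) (q' - q) (p' - p) s t‖ ^ 3 := by
  have h : ∀ s t : ℝ, dot (q - p + s • (q' - q) - t • (p' - p)) (cross (q' - q) (p' - p)) =
      dot (q - p) (cross (q' - q) (p' - p)) := triple_diffPoint _ _ _
  simp only [gaussT, diffPoint, h]

/-- The factor `V * m` keeps the sign of `V`, which is lost in the arctangent. -/
theorem exists_eq_mul_exp_arctan (g : ℝ) {V R : ℝ} (h0 : V ≠ 0) (hR : 0 < R) :
    ∃ m : ℝ, 0 < m ∧ (⟨V * R, g⟩ : ℂ) =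
      (V * m : ℝ) * Complex.exp (Complex.I * (Real.arctan (g / (V * R)) : ℝ)) := by
  set x := g / (V * R) with hx
  have hs : 0 < √(1 + x ^ 2) := by positivity
  refine ⟨R * √(1 + x ^ 2), by positivity, ?_⟩
  rw [mul_comm Complex.I, Complex.exp_mul_I, ← Complex.ofReal_cos, ← Complex.ofReal_sin,
    Real.cos_arctan, Real.sin_arctan]
  have hg : g = V * R * x := by rw [hx]; field_simp
  apply Complex.ext
  · simp
    field_simp
  · simp
    rw [hg]
    field_simp

/-! ### Corner angles and spherical excess -/

/-- The corner angle at `u`, between the planes spanned by `u, v` and by `u, w`, as the argument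
of a complex number. -/
noncomputable def cornerC (u v w : Space) : ℂ :=
  ⟨dot u u * dot v w - dot u v * dot u w, ‖u‖ * dot u (cross v w)⟩

/-- The product of two triple products as the determinant of the matrix of dot products. -/
theorem triple_mul_triple (u v w z : Space) :
    dot u (cross v w) * dot u (cross w z) =
      dot u u * (dot v w * dot w z - dot v z * dot w w)
        - dot u v * (dot u w * dot w z - dot w w * dot u z)
        + dot u w * (dot u w * dot v z - dot v w * dot u z) := by
  simp only [dot_eq, cross_apply_zero, cross_apply_one, cross_apply_two]; ring

/-- Adjacent corner angles add up. -/
theorem cornerC_mul (u v w z : Space) :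
    cornerC u v w * cornerC u w z = (dot u u * dot w w - dot u w ^ 2 : ℝ) * cornerC u v z := by
  have h2 : (dot u u * dot v w - dot u v * dot u w) * dot u (cross w z) +
      dot u (cross v w) * (dot u u * dot w z - dot u w * dot u z) =
      (dot u u * dot w w - dot u w ^ 2) * dot u (cross v z) := by
    simp only [dot_eq, cross_apply_zero, cross_apply_one, cross_apply_two]; ring
  have h1 := triple_mul_triple u v w z
  apply Complex.ext
  · simp only [cornerC, Complex.mul_re, Complex.ofReal_re, Complex.ofReal_im]
    linear_combination (-dot u u) * h1 +
      (dot u (cross v w) * dot u (cross w z)) * dot_self u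
  · simp only [cornerC, Complex.mul_im, Complex.ofReal_re, Complex.ofReal_im]
    linear_combination ‖u‖ * h2

theorem cornerC_smul (u v w : Space) {k l m : ℝ} (hk : 0 ≤ k) :
    cornerC (k • u) (l • v) (m • w) = (k ^ 2 * l * m : ℝ) * cornerC u v w := by
  apply Complex.ext <;>
  simp only [cornerC, dot_smul_left, dot_smul_right, cross_smul_left, cross_smul_right, norm_smul,
    Real.norm_of_nonneg hk, Complex.mul_re, Complex.mul_im, Complex.ofReal_re,
    Complex.ofReal_im] <;> ring

/-- The number `1 + u ⬝ w + u ⬝ v + v ⬝ w + i v ⬝ (u × w)`, whose argument is half the signed solid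
angle of the triangle of unit vectors `u`, `w`, `v`. -/
noncomputable def halfAngleC (u v w : Space) : ℂ :=
  ⟨1 + dot u w + dot u v + dot v w, dot v (cross u w)⟩

/-- The area of a spherical triangle is its angular excess: the product of the three corner
numbers, of argument the sum of the angles, is a negative multiple of the square of the conjugate
of `halfAngleC`. -/
theorem prod_cornerC {u v w : Space} (hu : dot u u = 1) (hv : dot v v = 1) (hw : dot w w = 1) :
    2 * (cornerC u v w * cornerC v w u * cornerC w u v) =
      -((1 - dot u v) * (1 - dot v w) * (1 - dot u w) : ℝ) *
        (starRingEnd ℂ (halfAngleC u v w)) ^ 2 := by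
  have n1 : ∀ {z : Space}, dot z z = 1 → ‖z‖ = 1 := fun {z} h => by
    rw [dot_self] at h; exact (pow_eq_one_iff_of_nonneg (norm_nonneg z) two_ne_zero).mp h
  have t1 : dot v (cross w u) = dot u (cross v w) := by
    simp only [dot_eq, cross_apply_zero, cross_apply_one, cross_apply_two]; ring
  have t2 : dot w (cross u v) = dot u (cross v w) := by
    simp only [dot_eq, cross_apply_zero, cross_apply_one, cross_apply_two]; ring
  have t3 : dot v (cross u w) = -dot u (cross v w) := by
    simp only [dot_eq, cross_apply_zero, cross_apply_one, cross_apply_two]; ring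
  have hD := triple_mul_self u v w
  simp only [cornerC, halfAngleC, n1 hu, n1 hv, n1 hw, hu, hv, hw, t1, t2, t3, one_mul,
    dot_comm v u, dot_comm w u, dot_comm w v] at hD ⊢
  generalize dot u (cross v w) = D at *
  generalize dot u v = x at *
  generalize dot v w = y at *
  generalize dot u w = z at *
  have hD' : D ^ 2 = 1 + 2 * x * y * z - x ^ 2 - y ^ 2 - z ^ 2 := by linear_combination hD
  have hD3 : D ^ 3 = D * (1 + 2 * x * y * z - x ^ 2 - y ^ 2 - z ^ 2) := by rw [← hD']; ring
  have c2 : (2 : ℂ) = ((2 : ℝ) : ℂ) := by norm_num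
  rw [c2, ← Complex.ofReal_neg, sq]
  apply Complex.ext
  · simp only [Complex.mul_re, Complex.mul_im, Complex.ofReal_re, Complex.ofReal_im,
      Complex.conj_re, Complex.conj_im]
    ring_nf
    simp only [hD']
    ring
  · simp only [Complex.mul_re, Complex.mul_im, Complex.ofReal_re, Complex.ofReal_im,
      Complex.conj_re, Complex.conj_im]
    ring_nf
    simp only [hD3]
    ring

/-- The spherical quadrilateral `α β γ ω` is cut along the diagonal `α γ` into two triangles. -/
theorem prod_cornerC_quadrilateral {α β γ ω : Space} (hα : dot α α = 1) (hβ : dot β β = 1)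
    (hγ : dot γ γ = 1) (hω : dot ω ω = 1) :
    4 * ((1 - dot α γ ^ 2) ^ 2 : ℝ) *
        (cornerC α β ω * cornerC γ ω β * cornerC β γ α * cornerC ω α γ) =
      (((1 - dot α β) * (1 - dot β γ) * (1 - dot α γ)) *
        ((1 - dot α γ) * (1 - dot γ ω) * (1 - dot α ω)) : ℝ) *
        (starRingEnd ℂ (halfAngleC α β γ) * halfAngleC α ω γ) ^ 2 := by
  have h1 := prod_cornerC hα hβ hγ
  have h2 := prod_cornerC hα hγ hω
  have h3 : starRingEnd ℂ (halfAngleC α γ ω) = halfAngleC α ω γ := by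
    apply Complex.ext
    · simp [halfAngleC, dot_comm ω γ]; ring
    · simp only [halfAngleC, Complex.conj_im, dot_eq, cross_apply_zero, cross_apply_one,
        cross_apply_two]
      ring
  rw [h3] at h2
  have sα := cornerC_mul α β γ ω
  have sγ := cornerC_mul γ ω α β
  rw [hα, hγ, one_mul] at sα
  rw [hα, hγ, one_mul, dot_comm γ α] at sγ
  push_cast at *
  linear_combination (2 * (cornerC α γ ω * cornerC γ ω α * cornerC ω α γ)) * h1 +
    (-((1 - dot α β) * (1 - dot β γ) * (1 - dot α γ)) *
        (starRingEnd ℂ (halfAngleC α β γ)) ^ 2) * h2 -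
    (4 * cornerC β γ α * cornerC ω α γ * (1 - (dot α γ : ℂ) ^ 2) * cornerC γ ω β) * sα -
    (4 * cornerC β γ α * cornerC ω α γ * cornerC α β γ * cornerC α γ ω) * sγ

/-- A degenerate triangle of unit vectors whose convex hull misses the origin has angle `0`, not
`π`. -/
theorem halfAngleC_re_pos {u v w : Space} (hu : dot u u = 1) (hv : dot v v = 1)
    (hw : dot w w = 1) (h0 : dot v (cross u w) = 0)
    (hcone : ∀ l m n : ℝ, 0 ≤ l → 0 ≤ m → 0 ≤ n → 0 < l + m + n → l • u + m • v + n • w ≠ 0) :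
    0 < 1 + dot u w + dot u v + dot v w := by
  have n1 : ∀ {z : Space}, dot z z = 0 → z = 0 := fun {z} h => by simpa [dot] using h
  have hp : ∀ {y z : Space}, dot y y = 1 → dot z z = 1 → y + z ≠ 0 → 0 < 1 + dot y z := by
    intro y z hy hz h
    have e : dot (y + z) (y + z) = 2 * (1 + dot y z) := by
      rw [dot_add_left, dot_add_right, dot_add_right, hy, hz, dot_comm z y]; ring
    have : 0 < dot (y + z) (y + z) := by
      rw [dot_self]; have := norm_pos_iff.mpr h; positivity
    linarith
  have huv : 0 < 1 + dot u v := hp hu hv (by simpa using hcone 1 1 0)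
  have hvw : 0 < 1 + dot v w := hp hv hw (by simpa using hcone 0 1 1)
  have huw : 0 < 1 + dot u w := hp hu hw (by simpa using hcone 1 0 1)
  by_contra! hx
  have hD := triple_mul_self v u w
  rw [h0, hu, hv, hw, dot_comm v u] at hD
  -- The coefficients are a column of the adjugate of the singular Gram matrix of `u, v, w`.
  refine hcone (dot v w * dot u w - dot u v) (1 - dot u w ^ 2) (dot u v * dot u w - dot v w)
    (by nlinarith) ?_ (by nlinarith) ?_ (n1 ?_)
  · nlinarith [mul_pos huv hvw]
  · nlinarith [mul_pos huw hvw, mul_pos huv huw]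
  · simp only [dot_add_left, dot_add_right, dot_smul_left, dot_smul_right, hu, hv, hw,
      dot_comm v u, dot_comm w u, dot_comm w v]
    linear_combination (-(1 - dot u w ^ 2)) * hD

/-- A square root of `exp (2 i T)`, up to positive factors, has argument `T` if its imaginary part
has the sign of `T`. -/
theorem arg_eq_of_sq_eq {z : ℂ} {T k l : ℝ} (hk : 0 < k) (hl : 0 < l)
    (h : (k : ℂ) * z ^ 2 = l * Complex.exp (Complex.I * (2 * T : ℝ))) (hT : |T| < Real.pi)
    (hz : 0 < z.im * T) : z.arg = T := by
  have hT' := abs_lt.mp hT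
  have hc : 0 < √(l / k) := Real.sqrt_pos.mpr (div_pos hl hk)
  have hsq : z ^ 2 = ((√(l / k) : ℝ) * (Complex.cos T + Complex.sin T * Complex.I)) ^ 2 := by
    have e : (√(l / k) : ℂ) ^ 2 = l / k := by
      rw [← Complex.ofReal_pow, Real.sq_sqrt (div_pos hl hk).le]; push_cast; rfl
    have hk' : (k : ℂ) ≠ 0 := by exact_mod_cast hk.ne'
    rw [mul_pow, e, ← Complex.exp_mul_I, ← Complex.exp_nat_mul, div_mul_eq_mul_div,
      eq_div_iff hk', mul_comm, h]
    congr 2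
    push_cast
    ring
  rcases sq_eq_sq_iff_eq_or_eq_neg.mp hsq with e | e
  · rw [e]
    exact Complex.arg_mul_cos_add_sin_mul_I hc ⟨hT'.1, hT'.2.le⟩
  · exfalso
    have him : z.im = -(√(l / k) * Real.sin T) := by
      rw [e]; simp [Complex.sin_ofReal_re, Complex.cos_ofReal_im]
    rw [him] at hz
    have : 0 ≤ Real.sin T * T := by
      rcases le_total 0 T with h0 | h0
      · exact mul_nonneg (Real.sin_nonneg_of_nonneg_of_le_pi h0 hT'.2.le) h0
      · exact mul_nonneg_of_nonpos_of_nonpos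
          (Real.sin_nonpos_of_nonpos_of_neg_pi_le h0 hT'.1.le) h0
    nlinarith [mul_nonneg hc.le this]

/-! ### From the primitive to the corner numbers -/

/-- At the corner `a`, with neighbours `a - W` and `a + U`, the tangent in `cornerPrimitive` is read
off from `cornerC`. The next three lemmas treat the other corners; at the two that enter
`integral_density` with a minus sign, `cornerNum` is negated. -/
theorem cornerC_start (a U W : Space) :
    (⟨dot a (cross U W) * ‖a‖, cornerNum U W a⟩ : ℂ) = -Complex.I * cornerC a (a - W) (a + U) := by
  apply Complex.ext <;>
  simp only [cornerNum, cornerC, Complex.mul_re, Complex.mul_im, Complex.neg_re, Complex.neg_im,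
    Complex.I_re, Complex.I_im, dot_eq, cross_apply_zero, cross_apply_one, cross_apply_two,
    PiLp.add_apply, PiLp.sub_apply] <;> ring

theorem cornerC_end (c U W : Space) :
    (⟨dot c (cross U W) * ‖c‖, cornerNum U W c⟩ : ℂ) = -Complex.I * cornerC c (c + W) (c - U) := by
  apply Complex.ext <;>
  simp only [cornerNum, cornerC, Complex.mul_re, Complex.mul_im, Complex.neg_re, Complex.neg_im,
    Complex.I_re, Complex.I_im, dot_eq, cross_apply_zero, cross_apply_one, cross_apply_two,
    PiLp.add_apply, PiLp.sub_apply] <;> ring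

theorem cornerC_left (b U W : Space) :
    (⟨dot b (cross U W) * ‖b‖, -cornerNum U W b⟩ : ℂ) = -Complex.I * cornerC b (b + U) (b + W) := by
  apply Complex.ext <;>
  simp only [cornerNum, cornerC, Complex.mul_re, Complex.mul_im, Complex.neg_re, Complex.neg_im,
    Complex.I_re, Complex.I_im, dot_eq, cross_apply_zero, cross_apply_one, cross_apply_two,
    PiLp.add_apply] <;> ring

theorem cornerC_right (d U W : Space) :
    (⟨dot d (cross U W) * ‖d‖, -cornerNum U W d⟩ : ℂ) = -Complex.I * cornerC d (d - U) (d - W) := by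
  apply Complex.ext <;>
  simp only [cornerNum, cornerC, Complex.mul_re, Complex.mul_im, Complex.neg_re, Complex.neg_im,
    Complex.I_re, Complex.I_im, dot_eq, cross_apply_zero, cross_apply_one, cross_apply_two,
    PiLp.sub_apply] <;> ring

theorem one_sub_dot_pos {u v w : Space} (hu : dot u u = 1) (hv : dot v v = 1)
    (h : dot u (cross v w) ≠ 0) : 0 < 1 - dot u v := by
  have := gram_pos_of_triple h
  rw [hu, hv] at this
  nlinarith [sq_nonneg (1 - dot u v)]

theorem unitVec_triple (u v w : Space) :
    dot (unitVec u) (cross (unitVec v) (unitVec w)) = ‖u‖⁻¹ * ‖v‖⁻¹ * ‖w‖⁻¹ * dot u (cross v w) := by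
  simp only [unitVec, dot_smul_left, dot_smul_right, cross_smul_left, cross_smul_right]; ring

theorem cornerC_eq_unitVec {u v w : Space} (hu : u ≠ 0) (hv : v ≠ 0) (hw : w ≠ 0) :
    cornerC u v w = (‖u‖ ^ 2 * ‖v‖ * ‖w‖ : ℝ) * cornerC (unitVec u) (unitVec v) (unitVec w) := by
  rw [← cornerC_smul _ _ _ (norm_nonneg u), norm_smul_unitVec hu, norm_smul_unitVec hv,
    norm_smul_unitVec hw]

/-- The imaginary part of the product of the two triangle numbers has the sign of the solid
angle. -/
theorem im_halfAngleC_mul {a b c d : Space} (ha : a ≠ 0) (hb : b ≠ 0) (hc : c ≠ 0) (hd : d ≠ 0)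
    (hsum : b + d = a + c) :
    ‖a‖ * ‖b‖ * ‖c‖ * ‖d‖ * (starRingEnd ℂ (halfAngleC (unitVec a) (unitVec b) (unitVec c)) *
        halfAngleC (unitVec a) (unitVec d) (unitVec c)).im =
      dot d (cross a c) *
        ((1 + dot (unitVec a) (unitVec c)) * (‖a‖ + ‖b‖ + ‖c‖ + ‖d‖)) := by
  have hy : dot b (cross a c) = -dot d (cross a c) := by
    have e : b = a + c - d := by rw [← hsum]; abel
    rw [e]
    simp only [dot_eq, cross_apply_zero, cross_apply_one, cross_apply_two, PiLp.add_apply,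
      PiLp.sub_apply]
    ring
  -- `b + d = a + c`, paired with the diagonal direction `α + γ`.
  have key : dot (‖b‖ • unitVec b + ‖d‖ • unitVec d) (unitVec a + unitVec c) =
      dot (‖a‖ • unitVec a + ‖c‖ • unitVec c) (unitVec a + unitVec c) := by
    rw [norm_smul_unitVec ha, norm_smul_unitVec hb, norm_smul_unitVec hc, norm_smul_unitVec hd,
      hsum]
  simp only [dot_add_left, dot_add_right, dot_smul_left, dot_unitVec_self ha,
    dot_unitVec_self hc, dot_comm (unitVec c) (unitVec a), dot_comm (unitVec b) (unitVec a),
    dot_comm (unitVec d) (unitVec a)] at key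
  have hA := norm_ne_zero_iff.mpr ha
  have hB := norm_ne_zero_iff.mpr hb
  have hC := norm_ne_zero_iff.mpr hc
  have hD := norm_ne_zero_iff.mpr hd
  simp only [Complex.mul_im, Complex.conj_re, Complex.conj_im, halfAngleC, unitVec_triple, hy]
  field_simp
  linear_combination dot d (cross a c) * key

/-- The product of the four corner numbers of the parallelogram `a, b, c, d`, as read off from the
arctangents in `cornerPrimitive`, has twice the argument of the product of the triangle numbers. -/
theorem exists_sq_eq_exp {a b c d U W : Space} {V : ℝ} (hb : b = a - W) (hc : c = a + U - W)
    (hd : d = a + U) (hV : dot a (cross U W) = V) (h0 : V ≠ 0) :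
    ∃ k l : ℝ, 0 < k ∧ 0 < l ∧
      (k : ℂ) * (starRingEnd ℂ (halfAngleC (unitVec a) (unitVec b) (unitVec c)) *
        halfAngleC (unitVec a) (unitVec d) (unitVec c)) ^ 2 =
      l * Complex.exp (Complex.I * (cornerPrimitive U W V c - cornerPrimitive U W V d
        - cornerPrimitive U W V b + cornerPrimitive U W V a : ℝ)) := by
  have tr : ∀ {x : Space}, dot x (cross U W) = V → dot x (cross U W) ≠ 0 := fun h => h ▸ h0
  have hVb : dot b (cross U W) = V := by
    rw [hb, ← hV]
    simp only [dot_eq, cross_apply_zero, cross_apply_one, cross_apply_two, PiLp.sub_apply]; ring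
  have hVc : dot c (cross U W) = V := by
    rw [hc, ← hV]
    simp only [dot_eq, cross_apply_zero, cross_apply_one, cross_apply_two, PiLp.sub_apply,
      PiLp.add_apply]
    ring
  have hVd : dot d (cross U W) = V := by
    rw [hd, ← hV]
    simp only [dot_eq, cross_apply_zero, cross_apply_one, cross_apply_two, PiLp.add_apply]; ring
  have ha0 : a ≠ 0 := ne_zero_of_triple (tr hV)
  have hb0 : b ≠ 0 := ne_zero_of_triple (tr hVb)
  have hc0 : c ≠ 0 := ne_zero_of_triple (tr hVc)
  have hd0 : d ≠ 0 := ne_zero_of_triple (tr hVd)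
  have hA := norm_pos_iff.mpr ha0
  have hB := norm_pos_iff.mpr hb0
  have hC := norm_pos_iff.mpr hc0
  have hD := norm_pos_iff.mpr hd0
  have habc : dot a (cross b c) = V := by
    rw [← hV, hb, hc]
    simp only [dot_eq, cross_apply_zero, cross_apply_one, cross_apply_two, PiLp.sub_apply,
      PiLp.add_apply]
    ring
  have hacd : dot a (cross c d) = V := by
    rw [← hV, hd, hc]
    simp only [dot_eq, cross_apply_zero, cross_apply_one, cross_apply_two, PiLp.sub_apply,
      PiLp.add_apply]
    ring
  have ut : ∀ {x y z : Space}, x ≠ 0 → y ≠ 0 → z ≠ 0 → dot x (cross y z) = V →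
      dot (unitVec x) (cross (unitVec y) (unitVec z)) ≠ 0 := by
    intro x y z hx hy hz h
    have := norm_ne_zero_iff.mpr hx
    have := norm_ne_zero_iff.mpr hy
    have := norm_ne_zero_iff.mpr hz
    rw [unitVec_triple, h]
    positivity
  have cyc : ∀ x y z : Space, dot y (cross z x) = dot x (cross y z) := fun x y z => by
    simp only [dot_eq, cross_apply_zero, cross_apply_one, cross_apply_two]; ring
  have uα := dot_unitVec_self ha0
  have uβ := dot_unitVec_self hb0
  have uγ := dot_unitVec_self hc0
  have uω := dot_unitVec_self hd0
  have p1 : 0 < 1 - dot (unitVec a) (unitVec b) := one_sub_dot_pos uα uβ (ut ha0 hb0 hc0 habc)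
  have p2 : 0 < 1 - dot (unitVec b) (unitVec c) :=
    one_sub_dot_pos uβ uγ (ut hb0 hc0 ha0 ((cyc _ _ _).trans habc))
  have p3 : 0 < 1 - dot (unitVec a) (unitVec c) := one_sub_dot_pos uα uγ (ut ha0 hc0 hd0 hacd)
  have p4 : 0 < 1 - dot (unitVec c) (unitVec d) :=
    one_sub_dot_pos uγ uω (ut hc0 hd0 ha0 ((cyc _ _ _).trans hacd))
  have p5 : 0 < 1 - dot (unitVec a) (unitVec d) := by
    rw [dot_comm]
    exact one_sub_dot_pos uω uα (ut hd0 ha0 hc0 ((cyc _ _ _).trans ((cyc _ _ _).trans hacd)))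
  have p6 : 0 < 1 - dot (unitVec a) (unitVec c) ^ 2 := by
    have := gram_pos_of_triple (ut ha0 hc0 hd0 hacd)
    rwa [uα, uγ, one_mul] at this
  obtain ⟨ma, hma, ea⟩ := exists_eq_mul_exp_arctan (cornerNum U W a) h0 hA
  obtain ⟨mb, hmb, eb⟩ := exists_eq_mul_exp_arctan (-cornerNum U W b) h0 hB
  obtain ⟨mc, hmc, ec⟩ := exists_eq_mul_exp_arctan (cornerNum U W c) h0 hC
  obtain ⟨md, hmd, ed⟩ := exists_eq_mul_exp_arctan (-cornerNum U W d) h0 hD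
  have fa := cornerC_start a U W
  have fb := cornerC_left b U W
  have fc := cornerC_end c U W
  have fd := cornerC_right d U W
  rw [hV, ea, ← hb, ← hd, cornerC_eq_unitVec ha0 hb0 hd0] at fa
  rw [hVb, eb, show b + U = c by rw [hb, hc]; abel, show b + W = a by rw [hb]; abel,
    cornerC_eq_unitVec hb0 hc0 ha0] at fb
  rw [hVc, ec, show c + W = d by rw [hd, hc]; abel, show c - U = b by rw [hb, hc]; abel,
    cornerC_eq_unitVec hc0 hd0 hb0] at fc
  rw [hVd, ed, show d - U = a by rw [hd]; abel, show d - W = c by rw [hd, hc],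
    cornerC_eq_unitVec hd0 ha0 hc0] at fd
  have hexp : Complex.exp (Complex.I * (cornerPrimitive U W V c - cornerPrimitive U W V d
        - cornerPrimitive U W V b + cornerPrimitive U W V a : ℝ)) =
      Complex.exp (Complex.I * (Real.arctan (cornerNum U W a / (V * ‖a‖)) : ℝ)) *
      Complex.exp (Complex.I * (Real.arctan (cornerNum U W c / (V * ‖c‖)) : ℝ)) *
      Complex.exp (Complex.I * (Real.arctan (-cornerNum U W b / (V * ‖b‖)) : ℝ)) *
      Complex.exp (Complex.I * (Real.arctan (-cornerNum U W d / (V * ‖d‖)) : ℝ)) := by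
    simp only [← Complex.exp_add, neg_div, Real.arctan_neg, cornerPrimitive]
    congr 1
    push_cast
    ring
  have quad := prod_cornerC_quadrilateral uα uβ uγ uω
  refine ⟨(‖a‖ ^ 2 * ‖b‖ * ‖d‖) * (‖c‖ ^ 2 * ‖d‖ * ‖b‖) * (‖b‖ ^ 2 * ‖c‖ * ‖a‖) *
      (‖d‖ ^ 2 * ‖a‖ * ‖c‖) * (((1 - dot (unitVec a) (unitVec b)) *
      (1 - dot (unitVec b) (unitVec c)) * (1 - dot (unitVec a) (unitVec c))) *
      ((1 - dot (unitVec a) (unitVec c)) * (1 - dot (unitVec c) (unitVec d)) *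
      (1 - dot (unitVec a) (unitVec d)))),
    4 * (1 - dot (unitVec a) (unitVec c) ^ 2) ^ 2 * ((V ^ 2) ^ 2 * (ma * mb * mc * md)),
    by positivity, by positivity, ?_⟩
  rw [hexp, Complex.ofReal_mul, mul_assoc, ← quad]
  generalize Complex.exp _ = x1 at *
  generalize Complex.exp _ = x2 at *
  generalize Complex.exp _ = x3 at *
  generalize Complex.exp _ = x4 at *
  -- Each corner contributes a factor `-I`; the four of them multiply to `1`.
  have prod := congrArg₂ (· * ·) (congrArg₂ (· * ·) fa fc) (congrArg₂ (· * ·) fb fd)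
  push_cast at *
  linear_combination (-(4 * (1 - (dot (unitVec a) (unitVec c) : ℂ) ^ 2) ^ 2)) * prod -
    (4 * (1 - (dot (unitVec a) (unitVec c) : ℂ) ^ 2) ^ 2) *
      ((‖a‖ ^ 2 * ‖b‖ * ‖d‖) * (‖c‖ ^ 2 * ‖d‖ * ‖b‖) * (‖b‖ ^ 2 * ‖c‖ * ‖a‖) *
        (‖d‖ ^ 2 * ‖a‖ * ‖c‖)) *
      (cornerC (unitVec a) (unitVec b) (unitVec d) * cornerC (unitVec c) (unitVec d) (unitVec b) *
        cornerC (unitVec b) (unitVec c) (unitVec a) * cornerC (unitVec d) (unitVec a) (unitVec c)) *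
      Complex.I_pow_four

/-! ### Disjoint segments -/

/-- Disjoint segments: no nontrivial nonnegative combination of the four differences vanishes. -/
theorem cone_ne_zero {p p' q q' : Space} (hdisj : Disjoint (segment ℝ p p') (segment ℝ q q'))
    {k l m n : ℝ} (hk : 0 ≤ k) (hl : 0 ≤ l) (hm : 0 ≤ m) (hn : 0 ≤ n)
    (hS : 0 < k + l + m + n) :
    k • (q - p) + l • (q - p') + m • (q' - p') + n • (q' - p) ≠ 0 := by
  intro h
  have hS' := hS.ne'
  have h1 : ((k + n) / (k + l + m + n)) • p + ((l + m) / (k + l + m + n)) • p' ∈ segment ℝ p p' :=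
    ⟨_, _, by positivity, by positivity, by field_simp; ring, rfl⟩
  refine Set.disjoint_left.mp hdisj h1
    ⟨(k + l) / (k + l + m + n), (m + n) / (k + l + m + n), by positivity, by positivity,
      by field_simp; ring, ?_⟩
  rw [← sub_eq_zero, ← smul_zero (k + l + m + n)⁻¹, ← h]
  module

theorem cone_unitVec_ne_zero {p p' q q' : Space}
    (hdisj : Disjoint (segment ℝ p p') (segment ℝ q q'))
    {k l m n : ℝ} (hk : 0 ≤ k) (hl : 0 ≤ l) (hm : 0 ≤ m) (hn : 0 ≤ n)
    (hS : 0 < k + l + m + n) :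
    k • unitVec (q - p) + l • unitVec (q - p') + m • unitVec (q' - p') +
      n • unitVec (q' - p) ≠ 0 := by
  have hA : 0 < ‖q - p‖ := norm_pos_iff.mpr
    (by simpa using cone_ne_zero hdisj (k := 1) (l := 0) (m := 0) (n := 0))
  have hB : 0 < ‖q - p'‖ := norm_pos_iff.mpr
    (by simpa using cone_ne_zero hdisj (k := 0) (l := 1) (m := 0) (n := 0))
  have hC : 0 < ‖q' - p'‖ := norm_pos_iff.mpr
    (by simpa using cone_ne_zero hdisj (k := 0) (l := 0) (m := 1) (n := 0))
  have hD : 0 < ‖q' - p‖ := norm_pos_iff.mpr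
    (by simpa using cone_ne_zero hdisj (k := 0) (l := 0) (m := 0) (n := 1))
  simp only [unitVec, smul_smul]
  refine cone_ne_zero hdisj (by positivity) (by positivity) (by positivity) (by positivity) ?_
  by_contra! hle
  have e1 : 0 ≤ k * ‖q - p‖⁻¹ := by positivity
  have e2 : 0 ≤ l * ‖q - p'‖⁻¹ := by positivity
  have e3 : 0 ≤ m * ‖q' - p'‖⁻¹ := by positivity
  have e4 : 0 ≤ n * ‖q' - p‖⁻¹ := by positivity
  have f1 : k * ‖q - p‖⁻¹ = 0 := by linarith
  have f2 : l * ‖q - p'‖⁻¹ = 0 := by linarith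
  have f3 : m * ‖q' - p'‖⁻¹ = 0 := by linarith
  have f4 : n * ‖q' - p‖⁻¹ = 0 := by linarith
  simp only [mul_eq_zero, inv_eq_zero, hA.ne', hB.ne', hC.ne', hD.ne', or_false] at f1 f2 f3 f4
  linarith

/-! ### The Gauss integral as an argument -/

/-- The half solid angle of a nondegenerate configuration is the argument of the product of the
triangle numbers. -/
theorem gaussT_eq_arg {p p' q q' : Space} {V : ℝ}
    (hV : dot (q - p) (cross (q' - q) (p' - p)) = V) (h0 : V ≠ 0) :
    0 < V * (starRingEnd ℂ (halfAngleC (unitVec (q - p)) (unitVec (q - p')) (unitVec (q' - p'))) *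
        halfAngleC (unitVec (q - p)) (unitVec (q' - p)) (unitVec (q' - p'))).im ∧
    (starRingEnd ℂ (halfAngleC (unitVec (q - p)) (unitVec (q - p')) (unitVec (q' - p'))) *
        halfAngleC (unitVec (q - p)) (unitVec (q' - p)) (unitVec (q' - p'))).arg =
      gaussT p p' q q' := by
  have hb : q - p' = (q - p) - (p' - p) := by abel
  have hc : q' - p' = (q - p) + (q' - q) - (p' - p) := by abel
  have hd : q' - p = (q - p) + (q' - q) := by abel
  have hsum : (q - p') + (q' - p) = (q - p) + (q' - p') := by abel
  obtain ⟨k, l, hk, hl, hsq⟩ := exists_sq_eq_exp hb hc hd hV h0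
  have hI := integral_density hV h0
  have hpos := integral_density_pos hV h0
  have habs := abs_integral_density_lt hV h0
  have hT := gaussT_eq p p' q q'
  rw [← hc, ← hd, ← hb] at hI
  simp only [hV] at hT
  rw [← hI] at hsq
  generalize q - p = a at *
  generalize q - p' = b at *
  generalize q' - p' = c at *
  generalize q' - p = d at *
  generalize q' - q = U at *
  generalize p' - p = W at *
  have tr : ∀ {x y z : Space}, dot x (cross y z) = V → x ≠ 0 := fun {x y z} h =>
    ne_zero_of_triple (U := y) (W := z) (by rw [h]; exact h0)
  have ha0 : a ≠ 0 := tr hV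
  have hb0 : b ≠ 0 := tr (y := U) (z := W) (by
    rw [hb, ← hV]
    simp only [dot_eq, cross_apply_zero, cross_apply_one, cross_apply_two, PiLp.sub_apply]; ring)
  have hc0 : c ≠ 0 := tr (y := U) (z := W) (by
    rw [hc, ← hV]
    simp only [dot_eq, cross_apply_zero, cross_apply_one, cross_apply_two, PiLp.sub_apply,
      PiLp.add_apply]
    ring)
  have hdV : dot d (cross a c) = V := by
    rw [hd, hc, ← hV]
    simp only [dot_eq, cross_apply_zero, cross_apply_one, cross_apply_two, PiLp.sub_apply,
      PiLp.add_apply]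
    ring
  have hd0 : d ≠ 0 := tr hdV
  have him := im_halfAngleC_mul ha0 hb0 hc0 hd0 hsum
  rw [hdV] at him
  have hA := norm_pos_iff.mpr ha0
  have hB := norm_pos_iff.mpr hb0
  have hC := norm_pos_iff.mpr hc0
  have hD := norm_pos_iff.mpr hd0
  have hac : 0 < 1 + dot (unitVec a) (unitVec c) := by
    have h : dot a (cross c d) ≠ 0 := by
      have e : dot a (cross c d) = dot d (cross a c) := by
        simp only [dot_eq, cross_apply_zero, cross_apply_one, cross_apply_two]; ring
      rw [e, hdV]; exact h0
    have h' : dot (unitVec a) (cross (unitVec c) (unitVec d)) ≠ 0 := by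
      rw [unitVec_triple]; positivity
    have := gram_pos_of_triple h'
    rw [dot_unitVec_self ha0, dot_unitVec_self hc0] at this
    nlinarith [sq_nonneg (1 + dot (unitVec a) (unitVec c))]
  generalize starRingEnd ℂ (halfAngleC (unitVec a) (unitVec b) (unitVec c)) *
        halfAngleC (unitVec a) (unitVec d) (unitVec c) = z at *
  generalize (∫ t in (0 : ℝ)..1, ∫ s in (0 : ℝ)..1, V / ‖diffPoint a U W s t‖ ^ 3) = I at *
  have hVz : 0 < V * z.im := by
    have h2 : ‖a‖ * ‖b‖ * ‖c‖ * ‖d‖ * (V * z.im) =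
        V ^ 2 * ((1 + dot (unitVec a) (unitVec c)) * (‖a‖ + ‖b‖ + ‖c‖ + ‖d‖)) := by
      linear_combination V * him
    have h3 : 0 < ‖a‖ * ‖b‖ * ‖c‖ * ‖d‖ * (V * z.im) := by rw [h2]; positivity
    exact pos_of_mul_pos_right h3 (by positivity)
  refine ⟨hVz, arg_eq_of_sq_eq hk hl (T := gaussT p p' q q') ?_ ?_ ?_⟩
  · rw [hsq, hT]; congr 4; ring
  · rw [hT, abs_mul, abs_of_pos one_half_pos]; linarith
  · have h2 : 0 < V ^ 2 * (z.im * I) := by nlinarith [mul_pos hVz hpos]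
    have := pos_of_mul_pos_right h2 (sq_nonneg V)
    rw [hT]; linarith

theorem mainTheorem2 (p p' q q' : Space)
    (hdisj : Disjoint (segment ℝ p p') (segment ℝ q q')) :
    let α : Space := unitVec (q - p)
    let β : Space := unitVec (q - p')
    let γ : Space := unitVec (q' - p')
    let ω : Space := unitVec (q' - p)
    let x : ℝ := 1 + dot α γ + dot α β + dot β γ
    let y : ℝ := dot β (cross α γ)
    let x' : ℝ := 1 + dot α γ + dot α ω + dot ω γ
    let y' : ℝ := dot ω (cross α γ)
    let x'' : ℝ := x * x' + y * y'
    let y'' : ℝ := x * y' - y * x'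
    (x, y) ≠ (0, 0) ∧ (x', y') ≠ (0, 0) ∧
      ∃ h : (x'', y'') ≠ (0, 0),
        gaussT p p' q q' = (AngleTriple.mk x'' y'' (sigmaRule y x'' y'') h).angle := by
  intro α β γ ω x y x' y' x'' y''
  have ha0 : q - p ≠ 0 := by simpa using cone_ne_zero hdisj (k := 1) (l := 0) (m := 0) (n := 0)
  have hb0 : q - p' ≠ 0 := by simpa using cone_ne_zero hdisj (k := 0) (l := 1) (m := 0) (n := 0)
  have hc0 : q' - p' ≠ 0 := by simpa using cone_ne_zero hdisj (k := 0) (l := 0) (m := 1) (n := 0)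
  have hd0 : q' - p ≠ 0 := by simpa using cone_ne_zero hdisj (k := 0) (l := 0) (m := 0) (n := 1)
  have hA := norm_pos_iff.mpr ha0
  have hB := norm_pos_iff.mpr hb0
  have hC := norm_pos_iff.mpr hc0
  have hD := norm_pos_iff.mpr hd0
  obtain ⟨V, hV⟩ : ∃ V, dot (q - p) (cross (q' - q) (p' - p)) = V := ⟨_, rfl⟩
  have hy : y = -(‖q - p'‖⁻¹ * ‖q - p‖⁻¹ * ‖q' - p'‖⁻¹ * V) := by
    simp only [y, α, β, γ, unitVec_triple, ← hV]
    simp only [dot_eq, cross_apply_zero, cross_apply_one, cross_apply_two, PiLp.sub_apply]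
    ring
  have hy' : y' = ‖q' - p‖⁻¹ * ‖q - p‖⁻¹ * ‖q' - p'‖⁻¹ * V := by
    simp only [y', α, ω, γ, unitVec_triple, ← hV]
    simp only [dot_eq, cross_apply_zero, cross_apply_one, cross_apply_two, PiLp.sub_apply]
    ring
  have hangle : ∀ h : (x'', y'') ≠ (0, 0), sigmaRule y x'' y'' = 0 →
      (AngleTriple.mk x'' y'' (sigmaRule y x'' y'') h).angle = Complex.arg ⟨x'', y''⟩ := by
    intro h hσ
    simp [AngleTriple.angle, atan2, hσ]
  have hσ : pointSign x'' y'' * y ≤ 0 → sigmaRule y x'' y'' = 0 := fun h => by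
    simp [sigmaRule, not_lt.mpr h]
  by_cases h0 : V = 0
  · -- Coplanar case: the integrand vanishes and both triangle numbers are positive reals.
    have hy0 : y = 0 := by rw [hy, h0]; ring
    have hy0' : y' = 0 := by rw [hy', h0]; ring
    have hx : 0 < x := by
      refine halfAngleC_re_pos (dot_unitVec_self ha0) (dot_unitVec_self hb0)
        (dot_unitVec_self hc0) hy0 fun l m n hl hm hn hs => ?_
      have := cone_unitVec_ne_zero hdisj hl hm hn le_rfl (by linarith)
      rwa [zero_smul, add_zero] at this
    have hx' : 0 < x' := by
      refine halfAngleC_re_pos (dot_unitVec_self ha0) (dot_unitVec_self hd0)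
        (dot_unitVec_self hc0) hy0' fun l m n hl hm hn hs => ?_
      have := cone_unitVec_ne_zero hdisj hl le_rfl hn hm (by linarith)
      rwa [zero_smul, add_zero, add_right_comm] at this
    have hx'' : 0 < x'' := by
      have : x'' = x * x' := by simp only [x'', hy0]; ring
      rw [this]; exact mul_pos hx hx'
    have hy'' : y'' = 0 := by simp only [y'', hy0, hy0']; ring
    refine ⟨fun h => hx.ne' (Prod.ext_iff.mp h).1, fun h => hx'.ne' (Prod.ext_iff.mp h).1,
      fun h => hx''.ne' (Prod.ext_iff.mp h).1, ?_⟩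
    rw [hangle _ (hσ (by rw [hy0, mul_zero])), hy'', gaussT_eq, hV, h0]
    have : (⟨x'', 0⟩ : ℂ) = (x'' : ℂ) := rfl
    rw [this, Complex.arg_ofReal_of_nonneg hx''.le]
    simp
  · obtain ⟨him, harg⟩ := gaussT_eq_arg hV h0
    have hz : starRingEnd ℂ (halfAngleC α β γ) * halfAngleC α ω γ = ⟨x'', y''⟩ := by
      apply Complex.ext
      · simp only [halfAngleC, Complex.mul_re, Complex.conj_re, Complex.conj_im, x'', x, x', y, y']
        ring
      · simp only [halfAngleC, Complex.mul_im, Complex.conj_re, Complex.conj_im, y'', x, x', y, y']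
        ring
    rw [hz] at him harg
    change 0 < V * y'' at him
    have hyne : y ≠ 0 := by rw [hy]; exact neg_ne_zero.mpr (by positivity)
    have hyne' : y' ≠ 0 := by rw [hy']; positivity
    refine ⟨fun h => hyne (Prod.ext_iff.mp h).2, fun h => hyne' (Prod.ext_iff.mp h).2,
      fun h => (right_ne_zero_of_mul him.ne') (Prod.ext_iff.mp h).2, ?_⟩
    rw [hangle _ (hσ ?_), harg]
    have hK : 0 < ‖q - p'‖⁻¹ * ‖q - p‖⁻¹ * ‖q' - p'‖⁻¹ := by positivity
    -- `y` and `y''` have opposite signs, hence no multiple of `2 * π` is added.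
    rcases pos_and_pos_or_neg_and_neg_of_mul_pos him with ⟨h1, h2⟩ | ⟨h1, h2⟩
    · have hs : pointSign x'' y'' = 1 := by simp [pointSign, h2]
      rw [hs, hy]
      push_cast
      linarith [mul_pos hK h1]
    · have hs : pointSign x'' y'' = -1 := by simp [pointSign, h2.not_gt, h2.ne]
      rw [hs, hy]
      push_cast
      linarith [mul_neg_of_pos_of_neg hK h1]
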